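/- For an integer $t\ge 0$ define the $q$-series $$\mathcal U_{2t}(q)=\sum_{1\le k_1<\cdots<k_t}\frac{q^{k_1+\cdots+k_t}}{(1-q^{k_1})^2\cdots(1-q^{k_t})^2},\qquad \mathcal U^{\star}_{2t}(q)=\sum_{1\le k_1\le\cdots\le k_t}\frac{q^{k_1+\cdots+k_t}}{(1-q^{k_1})^2\cdots(1-q^{k_t})^2},$$ $$\mathcal C_{2t}(q)=\sum_{0<s_1<\cdots<s_t}\frac{q^{2s_1+\cdots+2s_t-t}}{(1-q^{2s_1-1})^2\cdots(1-q^{2s_t-1})^2}$$ (so that each of them is $1$ for $t=0$), and write $(a;q)_\infty=(1-a)(1-aq)(1-aq^2)\cdots$ and $(q)_\infty=(q;q)_\infty$. Then $$\sum_{t\ge0}\mathcal U_{2t}(q)=\frac{(q^6)_\infty}{(q)_\infty(q^2)_\infty(q^3)_\infty},\qquad \sum_{t\ge0}\mathcal C_{2t}(q)=\frac{(q^4)_\infty(q^6)_\infty^2}{(q)_\infty(q^3)_\infty(q^{12})_\infty},$$ $$\sum_{t\ge0}\mathcal U^{\star}_{2t}(q)=\sum_{n\ge1}\frac{(-1)^{n-1}(1-q^n)(1-q^{2n})\,q^{\binom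 n2}}{1-3q^n+q^{2n}}.$$ These three identities hold in the ring $\mathbb Z[[q]]$ of formal power series, all infinite sums and products converging there coefficientwise. They also hold for complex numbers $q$ with $|q|<1$, all infinite sums and products being convergent, where for the third identity one assumes in addition that $|q^n|<|1-q^n|^2$ for every $n\ge1$ (this makes the sum over $t$ converge). -/

import Mathlib

open scoped PowerSeries PowerSeries.WithPiTopology

/-!
All series below are defined in an arbitrary commutative topological ring `R`, for an element `q` of
`R`, so that the same definitions serve for `q` the variable of `ℤ⟦X⟧` (with the topology of
coefficientwise convergence, `ℤ` being discrete) and for `q` a complex number.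
`Ring.inverse x` is the inverse of `x` when `x` is a unit; in a field it is `x⁻¹`.
-/

namespace MacMahon

variable {R : Type*} [CommRing R]

/-- The summand `q^(k₁+⋯+k_t) / ((1-q^{k₁})²⋯(1-q^{k_t})²)`. -/
noncomputable def uTerm (q : R) {t : ℕ} (k : Fin t → ℕ+) : R :=
  q ^ (∑ i, (k i : ℕ)) * Ring.inverse (∏ i, (1 - q ^ (k i : ℕ)) ^ 2)

/-- The summand `q^(2s₁+⋯+2s_t-t) / ((1-q^{2s₁-1})²⋯(1-q^{2s_t-1})²)`; the natural subtractions do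
not truncate, as every `sᵢ` is at least `1`. -/
noncomputable def cTerm (q : R) {t : ℕ} (s : Fin t → ℕ+) : R :=
  q ^ ((∑ i, 2 * (s i : ℕ)) - t) * Ring.inverse (∏ i, (1 - q ^ (2 * (s i : ℕ) - 1)) ^ 2)

/-- The summand `(-1)^{n-1} (1-q^n) (1-q^{2n}) q^{n(n-1)/2} / (1-3q^n+q^{2n})`. -/
noncomputable def starTerm (q : R) (n : ℕ+) : R :=
  (-1) ^ ((n : ℕ) - 1) * (1 - q ^ (n : ℕ)) * (1 - q ^ (2 * (n : ℕ))) * q ^ ((n : ℕ).choose 2) *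
    Ring.inverse (1 - 3 * q ^ (n : ℕ) + q ^ (2 * (n : ℕ)))

variable [TopologicalSpace R]

/-- MacMahon's `𝒰_{2t}(q)`: the sum over all chains `1 ≤ k₁ < ⋯ < k_t`. -/
noncomputable def U (t : ℕ) (q : R) : R :=
  ∑' k : {k : Fin t → ℕ+ // StrictMono k}, uTerm q k.1

/-- MacMahon's `𝒞_{2t}(q)`: the sum over all chains `0 < s₁ < ⋯ < s_t`. -/
noncomputable def C (t : ℕ) (q : R) : R :=
  ∑' s : {s : Fin t → ℕ+ // StrictMono s}, cTerm q s.1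

/-- The series `𝒰⋆_{2t}(q)`: the sum over all weak chains `1 ≤ k₁ ≤ ⋯ ≤ k_t`. -/
noncomputable def UStar (t : ℕ) (q : R) : R :=
  ∑' k : {k : Fin t → ℕ+ // Monotone k}, uTerm q k.1

/-- `(a;q)_∞ = (1-a)(1-aq)(1-aq²)⋯`. -/
noncomputable def qPoch (a q : R) : R :=
  ∏' n : ℕ, (1 - a * q ^ n)

/-- The short-hand `(q)_∞ = (q;q)_∞`. -/
noncomputable def euler (q : R) : R :=
  qPoch q q

end MacMahon

/-!
Put `x_k = q ^ k / (1 - q ^ k) ^ 2`. Strict chains are finite sets and weak chains are finite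
multisets, so the three sums over `t` are `∏ (1 + x_k)`, the same product over odd `k`, and
`∏ 1 / (1 - x_k)`. The first follows from
`(1 + x_k) (1 - q ^ k) (1 - q ^ (2 k)) (1 - q ^ (3 k)) = 1 - q ^ (6 k)`, and the second by dividing
the first by its value at `q ^ 2`, which is the part with even `k`.

For the third let `Q_k = 1 - 3 q ^ k + q ^ (2 k) = (1 - q ^ k) ^ 2 (1 - x_k)`. The partial fraction
expansion `1 / (Q_1 ⋯ Q_N) = ∑_{k ≤ N} starTerm q k / ((q;q)_{N - k} (q;q)_{N + k})` is proved by
induction on `N`: since `Q_N = (1 - q ^ (N - k)) (1 - q ^ (N + k)) + q ^ (N - k) Q_k`, multiplying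
by `Q_N` leaves the expansion for `N - 1` and an alternating sum, which telescopes to `0`. Multiply
by `(q;q)_N ^ 2` and let `N → ∞`.

Everything happens in a complete normed commutative ring with `‖q‖ < 1`. Formal power series are
such a ring for the `X`-adic norm, whose topology is that of coefficientwise convergence.
-/

open Finset Filter Topology

namespace MacMahon

/-! ### Infinite products and sums over finite sets and multisets -/

section Distrib

variable {R : Type*} [NormedCommRing R] [CompleteSpace R]

theorem summable_norm_and_hasSum_prod_fin {β : Type*} {t : ℕ} {f : Fin t → β → R}
    (hf : ∀ i, Summable fun b => ‖f i b‖) :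
    (Summable fun g : Fin t → β => ‖∏ i, f i (g i)‖) ∧
      HasSum (fun g : Fin t → β => ∏ i, f i (g i)) (∏ i, ∑' b, f i b) := by
  induction t with
  | zero =>
    refine ⟨(hasSum_unique _).summable, ?_⟩
    simpa only [Fin.prod_univ_zero] using hasSum_unique fun _ : Fin 0 → β => (1 : R)
  | succ t ih =>
    obtain ⟨hs, ha⟩ := ih fun i => hf i.succ
    have hn := (hf 0).mul_norm hs
    rw [← (Fin.consEquiv fun _ : Fin (t + 1) => β).summable_iff,
      ← (Fin.consEquiv fun _ : Fin (t + 1) => β).hasSum_iff]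
    simp only [Function.comp_def, Fin.prod_univ_succ, Fin.consEquiv_apply, Fin.cons_zero,
      Fin.cons_succ]
    have hm := HasSum.mul (hf 0).of_norm.hasSum ha hn.of_norm
    exact ⟨hn, hm⟩

theorem summable_norm_and_hasSum_prod_pi {ι β : Type*} [Fintype ι] {f : ι → β → R}
    (hf : ∀ i, Summable fun b => ‖f i b‖) :
    (Summable fun g : ι → β => ‖∏ i, f i (g i)‖) ∧
      HasSum (fun g : ι → β => ∏ i, f i (g i)) (∏ i, ∑' b, f i b) := by
  let e := (Fintype.equivFin ι).symm
  obtain ⟨hs, ha⟩ := summable_norm_and_hasSum_prod_fin fun i => hf (e i)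
  rw [← (e.arrowCongr (Equiv.refl β)).symm.summable_iff] at hs
  rw [← (e.arrowCongr (Equiv.refl β)).symm.hasSum_iff] at ha
  simp_rw [← e.prod_comp]
  exact ⟨hs, ha⟩

end Distrib

section EulerProduct

variable {ι : Type*}

/-- A finitely supported `ℕ`-valued function is given by its support together with its values,
lowered by one, on the support. -/
noncomputable def finsuppNatEquiv : (Σ s : Finset ι, s → ℕ) ≃ (ι →₀ ℕ) :=
  Equiv.ofBijective (fun p => Finsupp.indicator p.1 fun i hi => p.2 ⟨i, hi⟩ + 1) (by
    classical
    constructor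
    · rintro ⟨s, n⟩ ⟨s', n'⟩ h
      have hv := fun i => DFunLike.congr_fun h i
      simp only [Finsupp.indicator_apply] at hv
      obtain rfl : s = s' := by ext i; grind
      congr
      ext i
      simpa using hv i
    · intro m
      refine ⟨⟨m.support, fun i => m i - 1⟩, ?_⟩
      ext i
      simp only [Finsupp.indicator_apply, Finsupp.mem_support_iff]
      grind)

theorem prod_finsuppNatEquiv {M : Type*} [CommMonoid M] {f : ι → ℕ → M} (h0 : ∀ i, f i 0 = 1)
    (p : Σ s : Finset ι, s → ℕ) :
    (finsuppNatEquiv p).prod f = ∏ i : p.1, f i (p.2 i + 1) :=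
  (Finsupp.prod_indicator_index_eq_prod_attach _ fun i _ => h0 i).trans rfl

variable {R : Type*} [NormedCommRing R] [NormOneClass R] {f : ι → ℕ → R}

theorem summable_norm_finsupp_prod (h0 : ∀ i, f i 0 = 1)
    (hf : Summable fun p : ι × ℕ => ‖f p.1 (p.2 + 1)‖) :
    Summable fun m : ι →₀ ℕ => ‖m.prod f‖ := by
  have hi (i : ι) : Summable fun n => ‖f i (n + 1)‖ :=
    hf.comp_injective (Prod.mk_right_injective i)
  have hfib (s : Finset ι) : HasSum (fun n : s → ℕ => ∏ i : s, ‖f i (n i + 1)‖)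
      (∏ i ∈ s, ∑' n, ‖f i (n + 1)‖) := by
    rw [← Finset.prod_coe_sort]
    exact (summable_norm_and_hasSum_prod_pi fun i : s => (hi i).norm).2
  have hbound : Summable fun p : Σ s : Finset ι, s → ℕ => ∏ i : p.1, ‖f i (p.2 i + 1)‖ := by
    refine (summable_sigma_of_nonneg fun p => prod_nonneg fun _ _ => norm_nonneg _).2
      ⟨fun s => (hfib s).summable, ?_⟩
    simp_rw [fun s => (hfib s).tsum_eq]
    exact summable_finsetProd_of_summable_nonneg (fun i => tsum_nonneg fun _ => norm_nonneg _)
      hf.prod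
  rw [← finsuppNatEquiv.summable_iff]
  refine hbound.of_nonneg_of_le (fun _ => norm_nonneg _) fun p => ?_
  rw [Function.comp_apply, prod_finsuppNatEquiv h0]
  exact Finset.norm_prod_le _ _

variable [CompleteSpace R]

theorem hasSum_finsupp_prod (h0 : ∀ i, f i 0 = 1)
    (hf : Summable fun p : ι × ℕ => ‖f p.1 (p.2 + 1)‖) :
    HasSum (fun m : ι →₀ ℕ => m.prod f) (∏' i, ∑' n, f i n) := by
  have hi (i : ι) : Summable fun n => ‖f i (n + 1)‖ :=
    hf.comp_injective (Prod.mk_right_injective i)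
  have hone (i : ι) : ∑' n, f i n = 1 + ∑' n, f i (n + 1) := by
    rw [((summable_nat_add_iff 1).1 (hi i).of_norm).tsum_eq_zero_add, h0]
  have hsum : Summable fun i => ‖∑' n, f i (n + 1)‖ :=
    hf.prod.of_nonneg_of_le (fun _ => norm_nonneg _) fun i => norm_tsum_le_tsum_norm (hi i)
  have hprod := summable_finsetProd_of_summable_norm hsum
  simp_rw [hone]
  rw [tprod_one_add hprod, ← finsuppNatEquiv.hasSum_iff]
  refine HasSum.sigma_of_hasSum hprod.hasSum (fun s => ?_)
    (finsuppNatEquiv.summable_iff.2 (summable_norm_finsupp_prod h0 hf).of_norm)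
  simp_rw [Function.comp_apply, prod_finsuppNatEquiv h0]
  rw [← Finset.prod_coe_sort]
  exact (summable_norm_and_hasSum_prod_pi fun i : s => hi i).2

end EulerProduct

section Inverse

variable {R : Type*} [NormedCommRing R] [CompleteSpace R]

theorem tendsto_ringInverse {ι : Type*} {l : Filter ι} {f : ι → R} {a : R} (ha : IsUnit a)
    (hf : Tendsto f l (𝓝 a)) : Tendsto (fun i => Ring.inverse (f i)) l (𝓝 (Ring.inverse a)) := by
  obtain ⟨u, rfl⟩ := ha
  exact (NormedRing.inverse_continuousAt u).tendsto.comp hf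

theorem summable_norm_mul_inverse {ι : Type*} {f g : ι → R} (hf : Summable fun i => ‖f i‖)
    (hg : Tendsto g cofinite (𝓝 1)) : Summable fun i => ‖f i * Ring.inverse (g i)‖ := by
  have hinv := tendsto_ringInverse isUnit_one hg
  rw [Ring.inverse_one] at hinv
  refine Summable.of_norm_bounded_eventually (hf.mul_right (‖(1 : R)‖ + 1)) ?_
  filter_upwards [hinv.norm.eventually_le_const (lt_add_one _)] with i hi
  rw [norm_norm]
  exact (norm_mul_le _ _).trans (by gcongr)

end Inverse

section Products

variable {ι R : Type*} [NormedCommRing R] [CompleteSpace R] [NormOneClass R] {x : ι → R}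

theorem multipliable_one_sub (hx : Summable fun k => ‖x k‖) : Multipliable fun k => 1 - x k := by
  simpa only [sub_eq_add_neg] using
    multipliable_one_add_of_summable (f := fun k => -x k) (by simpa using hx)

theorem multipliable_inverse_one_sub (hx1 : ∀ k, ‖x k‖ < 1) (hx : Summable fun k => ‖x k‖) :
    Multipliable fun k => Ring.inverse (1 - x k) := by
  have hone : Tendsto (fun k => 1 - x k) cofinite (𝓝 1) := by
    simpa using hx.of_norm.tendsto_cofinite_zero.const_sub 1
  have hinv (k : ι) : Ring.inverse (1 - x k) = 1 + x k * Ring.inverse (1 - x k) := by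
    linear_combination Ring.mul_inverse_cancel _ (isUnit_one_sub_of_norm_lt_one (hx1 k))
  rw [funext hinv]
  exact multipliable_one_add_of_summable (summable_norm_mul_inverse hx hone)

theorem isUnit_tprod_one_sub (hx1 : ∀ k, ‖x k‖ < 1) (hx : Summable fun k => ‖x k‖) :
    IsUnit (∏' k, (1 - x k)) := by
  refine IsUnit.of_mul_eq_one (∏' k, Ring.inverse (1 - x k)) ?_
  rw [← (multipliable_one_sub hx).tprod_mul (multipliable_inverse_one_sub hx1 hx)]
  simp [Ring.mul_inverse_cancel _ (isUnit_one_sub_of_norm_lt_one (hx1 _))]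

end Products

section Multisets

variable {α R : Type*} [NormedCommRing R] {x : α → R}

theorem summable_norm_pow_succ_prod (hx1 : ∀ k, ‖x k‖ < 1) (hx : Summable fun k => ‖x k‖) :
    Summable fun p : α × ℕ => ‖x p.1 ^ (p.2 + 1)‖ := by
  have hg (k : α) : HasSum (fun n => ‖x k‖ ^ (n + 1)) (‖x k‖ * Ring.inverse (1 - ‖x k‖)) := by
    have h := (hasSum_geom_series_inverse ‖x k‖ (by simpa using hx1 k)).mul_left ‖x k‖
    simpa only [pow_succ'] using h
  have hone : Tendsto (fun k => 1 - ‖x k‖) cofinite (𝓝 1) := by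
    simpa using hx.tendsto_cofinite_zero.const_sub 1
  have hbound : Summable fun p : α × ℕ => ‖x p.1‖ ^ (p.2 + 1) := by
    refine (summable_prod_of_nonneg fun _ => pow_nonneg (norm_nonneg _) _).2
      ⟨fun k => (hg k).summable, ?_⟩
    simp_rw [fun k => (hg k).tsum_eq]
    exact (summable_norm_mul_inverse hx.norm hone).of_norm
  exact hbound.of_nonneg_of_le (fun _ => norm_nonneg _) fun p => norm_pow_le' _ p.2.succ_pos

variable [CompleteSpace R]

theorem summable_prod_subtype (hx : Summable fun k => ‖x k‖) {t : ℕ} (p : (Fin t → α) → Prop) :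
    Summable fun k : {k : Fin t → α // p k} => ∏ i, x (k.1 i) :=
  ((summable_norm_and_hasSum_prod_pi fun _ => hx).1.comp_injective
    Subtype.val_injective).of_norm

variable [NormOneClass R]

theorem hasSum_multiset_prod (hx1 : ∀ k, ‖x k‖ < 1) (hx : Summable fun k => ‖x k‖) :
    HasSum (fun m : Multiset α => (m.map x).prod) (∏' k, Ring.inverse (1 - x k)) := by
  classical
  have h := Multiset.toFinsupp.toEquiv.hasSum_iff.2 <|
    hasSum_finsupp_prod (f := fun k n => x k ^ n) (fun k => pow_zero _)
      (summable_norm_pow_succ_prod hx1 hx)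
  simp_rw [fun k => geom_series_eq_inverse (x k) (hx1 k)] at h
  convert h using 2 with m
  exact Finset.prod_multiset_map_count m x

end Multisets

section Chains

variable {α : Type*} [LinearOrder α]

/-- The weak chains `k₁ ≤ ⋯ ≤ k_t` of arbitrary length `t` are the finite multisets. -/
noncomputable def weakChainEquiv : (Σ t : ℕ, {k : Fin t → α // Monotone k}) ≃ Multiset α :=
  Equiv.ofBijective (fun c => (List.ofFn c.2.1 : Multiset α)) (by
    constructor
    · rintro ⟨t, k, hk⟩ ⟨t', k', hk'⟩ h
      have hperm : (List.ofFn k).Perm (List.ofFn k') := Multiset.coe_eq_coe.1 h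
      obtain rfl : t = t' := by simpa using hperm.length_eq
      obtain rfl := List.ofFn_injective
        (hperm.eq_of_pairwise' hk.sortedLE_ofFn.pairwise hk'.sortedLE_ofFn.pairwise)
      rfl
    · intro m
      refine ⟨⟨(m.sort (· ≤ ·)).length, (m.sort (· ≤ ·)).get, ?_⟩, ?_⟩
      · rw [← List.sortedLE_ofFn_iff, List.ofFn_get]
        exact (Multiset.pairwise_sort _ _).sortedLE
      · exact (congrArg _ (List.ofFn_get _)).trans (Multiset.sort_eq _ _))

theorem prod_map_weakChainEquiv {M : Type*} [CommMonoid M] (x : α → M)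
    (c : Σ t : ℕ, {k : Fin t → α // Monotone k}) :
    ((weakChainEquiv c).map x).prod = ∏ i, x (c.2.1 i) := by
  change (((List.ofFn c.2.1 : List α) : Multiset α).map x).prod = _
  rw [Multiset.map_coe, Multiset.prod_coe, List.map_ofFn, List.prod_ofFn]
  rfl

/-- The strict chains `k₁ < ⋯ < k_t` of arbitrary length `t` are the finite sets. -/
noncomputable def strictChainEquiv : (Σ t : ℕ, {k : Fin t → α // StrictMono k}) ≃ Finset α :=
  Equiv.ofBijective (fun c => univ.map ⟨c.2.1, c.2.2.injective⟩) (by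
    constructor
    · rintro ⟨t, k, hk⟩ ⟨t', k', hk'⟩ h
      obtain rfl : t = t' := by simpa using congrArg Finset.card h
      obtain rfl : k = k' := by
        rw [← StrictMono.range_inj hk hk']
        simpa using congrArg (fun s : Finset α => (s : Set α)) h
      rfl
    · intro s
      refine ⟨⟨s.card, s.orderEmbOfFin rfl, (s.orderEmbOfFin rfl).strictMono⟩, ?_⟩
      apply coe_injective
      simp)

theorem prod_strictChainEquiv {M : Type*} [CommMonoid M] (x : α → M)
    (c : Σ t : ℕ, {k : Fin t → α // StrictMono k}) :
    ∏ k ∈ strictChainEquiv c, x k = ∏ i, x (c.2.1 i) :=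
  prod_map univ _ x

variable {R : Type*} [NormedCommRing R] [NormOneClass R] [CompleteSpace R] {x : α → R}

theorem hasSum_strictChain (hx : Summable fun k => ‖x k‖) :
    HasSum (fun t : ℕ => ∑' k : {k : Fin t → α // StrictMono k}, ∏ i, x (k.1 i))
      (∏' k, (1 + x k)) := by
  have hs := summable_finsetProd_of_summable_norm hx
  have h := strictChainEquiv.hasSum_iff.2 hs.hasSum
  rw [← tprod_one_add hs] at h
  simp_rw [Function.comp_def, prod_strictChainEquiv] at h
  exact h.sigma fun t => (summable_prod_subtype hx _).hasSum

theorem hasSum_weakChain (hx1 : ∀ k, ‖x k‖ < 1) (hx : Summable fun k => ‖x k‖) :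
    HasSum (fun t : ℕ => ∑' k : {k : Fin t → α // Monotone k}, ∏ i, x (k.1 i))
      (∏' k, Ring.inverse (1 - x k)) := by
  have h := weakChainEquiv.hasSum_iff.2 (hasSum_multiset_prod hx1 hx)
  simp_rw [Function.comp_def, prod_map_weakChainEquiv] at h
  exact h.sigma fun t => (summable_prod_subtype hx _).hasSum

end Chains

/-! ### Algebraic identities -/

section Ratio

variable {R : Type*} [CommRing R]

theorem inverse_prod {ι : Type*} (s : Finset ι) (f : ι → R) :
    Ring.inverse (∏ i ∈ s, f i) = ∏ i ∈ s, Ring.inverse (f i) :=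
  map_prod (MonoidWithZero.inverse : R →*₀ R) f s

/-- The quotient `q ^ n / (1 - q ^ n) ^ 2`, of which the summands of all three families of series
are products. -/
noncomputable def ratio (q : R) (n : ℕ) : R := q ^ n * Ring.inverse ((1 - q ^ n) ^ 2)

theorem uTerm_eq_prod (q : R) {t : ℕ} (k : Fin t → ℕ+) : uTerm q k = ∏ i, ratio q (k i) := by
  simp only [uTerm, ratio, prod_mul_distrib, inverse_prod, prod_pow_eq_pow_sum]

theorem cTerm_eq_prod (q : R) {t : ℕ} (s : Fin t → ℕ+) :
    cTerm q s = ∏ i, ratio q (2 * (s i : ℕ) - 1) := by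
  have hexp : ∑ i, (2 * (s i : ℕ) - 1) = (∑ i, 2 * (s i : ℕ)) - t := by
    rw [sum_tsub_distrib _ fun i _ => by have := (s i).pos; omega]
    simp
  simp only [cTerm, ratio, prod_mul_distrib, inverse_prod, prod_pow_eq_pow_sum, hexp]

theorem ratio_sq (q : R) (n : ℕ) : ratio (q ^ 2) n = ratio q (2 * n) := by
  simp only [ratio, pow_mul]

theorem one_add_ratio_mul {q : R} {n : ℕ} (h : IsUnit (1 - q ^ n)) :
    (1 + ratio q n) * ((1 - q ^ n) * (1 - (q ^ 2) ^ n) * (1 - (q ^ 3) ^ n)) = 1 - (q ^ 6) ^ n := by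
  rw [ratio, pow_right_comm q 2 n, pow_right_comm q 3 n, pow_right_comm q 6 n]
  have hinv := Ring.mul_inverse_cancel _ (h.pow 2)
  linear_combination (q ^ n * (1 + q ^ n) * (1 - (q ^ n) ^ 3)) * hinv

end Ratio

section PartialFractions

variable {R : Type*} [CommRing R]

/-- The finite `q`-Pochhammer symbol `(q;q)_n = (1 - q) ⋯ (1 - q ^ n)`. -/
def qFac (q : R) (n : ℕ) : R := ∏ k ∈ range n, (1 - q ^ (k + 1))

/-- The reciprocal `1 / (q;q)_n`. -/
noncomputable def invFac (q : R) (n : ℕ) : R := Ring.inverse (qFac q n)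

/-- The denominator `1 - 3 q ^ n + q ^ (2 n)` of `starTerm`, which is
`(1 - q ^ n) ^ 2 * (1 - ratio q n)`. -/
def quad (q : R) (n : ℕ) : R := 1 - 3 * q ^ n + q ^ (2 * n)

/-- The numerator `(-1) ^ i (1 - q ^ (i + 1)) (1 - q ^ (2 (i + 1))) q ^ (i (i - 1) / 2)`, which is
that of `starTerm q (i + 1)` up to a factor `q ^ i`. -/
def starNum (q : R) (i : ℕ) : R :=
  (-1) ^ i * (1 - q ^ (i + 1)) * (1 - q ^ (2 * (i + 1))) * q ^ i.choose 2

/-- The partial fraction expansion of `1 / (quad q 1 ⋯ quad q (n + 1))`. -/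
noncomputable def starSum (q : R) (n : ℕ) : R :=
  ∑ i ∈ range (n + 1), starTerm q i.succPNat * invFac q (n - i) * invFac q (n + 2 + i)

theorem qFac_succ (q : R) (n : ℕ) : qFac q (n + 1) = qFac q n * (1 - q ^ (n + 1)) :=
  prod_range_succ _ _

theorem quad_eq (q : R) (m d : ℕ) :
    quad q (m + d) = (1 - q ^ d) * (1 - q ^ (2 * m + d)) + q ^ d * quad q m := by
  simp only [quad]; ring

theorem quad_eq_mul {q : R} {n : ℕ} (h : IsUnit (1 - q ^ n)) :
    quad q n = (1 - q ^ n) ^ 2 * (1 - ratio q n) := by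
  rw [quad, ratio]
  linear_combination q ^ n * Ring.mul_inverse_cancel _ (h.pow 2)

theorem starTerm_succPNat (q : R) (i : ℕ) :
    starTerm q i.succPNat = q ^ i * starNum q i * Ring.inverse (quad q (i + 1)) := by
  rw [starTerm, starNum, quad, Nat.succPNat_coe, Nat.succ_eq_add_one, Nat.add_sub_cancel,
    Nat.choose_succ_succ', Nat.choose_one_right]
  ring

variable {q : R} (hq : ∀ n, 1 ≤ n → IsUnit (1 - q ^ n))
include hq

theorem one_sub_mul_invFac_succ (n : ℕ) : (1 - q ^ (n + 1)) * invFac q (n + 1) = invFac q n := by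
  rw [invFac, invFac, qFac_succ, Ring.mul_inverse_rev, ← mul_assoc,
    Ring.mul_inverse_cancel _ (hq _ n.succ_pos), one_mul]

-- Here `m + d` stands for `n` in `sum_starNum_eq_zero`, so that no subtraction `n - m` occurs.
theorem sum_starNum_partial (d m : ℕ) :
    (1 - q ^ (m + d)) *
        ∑ i ∈ range m, starNum q i * invFac q (m + d - i) * invFac q (m + d + 2 + i) =
      -(-1) ^ m * q ^ m.choose 2 * (1 - q ^ m) * (1 - q ^ (m + 1)) * invFac q d *
        invFac q (2 * m + d + 1) := by
  induction m generalizing d with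
  | zero => simp
  | succ m ih =>
    have hv := one_sub_mul_invFac_succ hq d
    have hw := one_sub_mul_invFac_succ hq (2 * m + d + 2)
    rw [show m + 1 + d = m + (d + 1) by ring, sum_range_succ, mul_add, ih (d + 1),
      Nat.add_sub_cancel_left, starNum, Nat.choose_succ_succ' m 1, Nat.choose_one_right]
    rw [show 2 * m + (d + 1) + 1 = 2 * m + d + 2 by ring,
      show m + (d + 1) + 2 + m = 2 * m + d + 2 + 1 by ring,
      show 2 * (m + 1) + d + 1 = 2 * m + d + 2 + 1 by ring, ← hv, ← hw]
    ring

theorem sum_starNum_eq_zero {n : ℕ} (hn : 1 ≤ n) :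
    ∑ i ∈ range (n + 1), starNum q i * invFac q (n - i) * invFac q (n + 2 + i) = 0 := by
  have h := sum_starNum_partial hq 0 n
  have hw := one_sub_mul_invFac_succ hq (2 * n + 1)
  refine (hq n hn).mul_right_eq_zero.1 ?_
  simp only [add_zero] at h
  rw [sum_range_succ, mul_add, h, ← hw, starNum, Nat.sub_self,
    show n + 2 + n = 2 * n + 1 + 1 by ring]
  ring

variable (hquad : ∀ n, 1 ≤ n → IsUnit (quad q n))
include hquad

theorem quad_mul_starSum_succ (n : ℕ) : quad q (n + 2) * starSum q (n + 1) = starSum q n := by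
  have hterm : ∀ i ∈ range (n + 2),
      quad q (n + 2) * (starTerm q i.succPNat * invFac q (n + 1 - i) * invFac q (n + 3 + i)) =
        starTerm q i.succPNat * ((1 - q ^ (n + 1 - i)) * invFac q (n + 1 - i)) *
            invFac q (n + 2 + i) +
          q ^ (n + 1) * (starNum q i * invFac q (n + 1 - i) * invFac q (n + 3 + i)) := by
    intro i hi
    obtain ⟨d, hd⟩ := Nat.exists_eq_add_of_le (Nat.lt_succ_iff.1 (mem_range.1 hi))
    have hw := one_sub_mul_invFac_succ hq (n + 2 + i)
    have hinv := Ring.inverse_mul_cancel _ (hquad (i + 1) i.succ_pos)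
    rw [starTerm_succPNat, show n + 2 = i + 1 + d by omega, quad_eq,
      ← show n + 2 = i + 1 + d by omega,
      show n + 1 - i = d by omega, ← hw, hd, show n + 3 + i = n + 2 + i + 1 by ring,
      show 2 * (i + 1) + d = n + 2 + i + 1 by omega]
    linear_combination
      (q ^ (i + d) * starNum q i * invFac q d * invFac q (n + 2 + i + 1)) * hinv
  have hzero := sum_starNum_eq_zero hq n.succ_pos
  rw [starSum, mul_sum, sum_congr rfl hterm, sum_add_distrib, ← mul_sum, hzero, mul_zero, add_zero,
    sum_range_succ, Nat.sub_self, pow_zero, sub_self, zero_mul, mul_zero, zero_mul, add_zero]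
  refine sum_congr rfl fun i hi => ?_
  rw [Nat.succ_sub (Nat.lt_succ_iff.1 (mem_range.1 hi)), one_sub_mul_invFac_succ hq]

theorem prod_quad_mul_starSum (n : ℕ) :
    (∏ i ∈ range (n + 1), quad q (i + 1)) * starSum q n = 1 := by
  induction n with
  | zero =>
    have hinv := Ring.inverse_mul_cancel _ (hquad 1 le_rfl)
    have hv1 := one_sub_mul_invFac_succ hq 0
    have hv2 := one_sub_mul_invFac_succ hq 1
    have hv0 : invFac q 0 = 1 := by simp [invFac, qFac]
    simp only [starSum, starTerm_succPNat, starNum, hv0, zero_add, sum_range_one,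
      prod_range_one, pow_zero, one_mul, mul_one, Nat.choose_zero_succ, tsub_self,
      add_zero, Nat.reduceAdd] at hinv hv1 hv2 ⊢
    linear_combination (1 - q ^ 1) * (1 - q ^ 2) * invFac q 2 * hinv + (1 - q ^ 1) * hv2 + hv1
  | succ n ih => rw [prod_range_succ, mul_assoc, quad_mul_starSum_succ hq hquad, ih]

theorem prod_inverse_quad_eq_starSum (n : ℕ) :
    ∏ i ∈ range (n + 1), Ring.inverse (quad q (i + 1)) = starSum q n := by
  have h := prod_quad_mul_starSum hq hquad n
  rw [← inverse_prod, ← mul_one (Ring.inverse _),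
    Ring.inverse_mul_eq_iff_eq_mul _ _ _ (IsUnit.of_mul_eq_one _ h), h]

end PartialFractions

/-! ### Identities in a complete normed ring -/

section UnitDisc

theorem injective_two_mul_sub_one : Function.Injective fun s : ℕ+ => 2 * (s : ℕ) - 1 :=
  fun a b h => PNat.eq (by have := a.pos; have := b.pos; simp only at h; omega)

theorem euler_eq_tprod {R : Type*} [CommRing R] [TopologicalSpace R] (q : R) :
    euler q = ∏' n : ℕ, (1 - q ^ (n + 1)) := by
  simp only [euler, qPoch, pow_succ']

variable {R : Type*} [NormedCommRing R] {q : R}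

theorem norm_pow_lt_one [NormOneClass R] (hq : ‖q‖ < 1) {n : ℕ} (hn : 1 ≤ n) : ‖q ^ n‖ < 1 :=
  (norm_pow_le q n).trans_lt (pow_lt_one₀ (norm_nonneg _) hq (by omega))

variable [CompleteSpace R] (hq : ‖q‖ < 1)
include hq

theorem summable_norm_ratio : Summable fun n => ‖ratio q n‖ := by
  have hpow := summable_norm_geometric_of_norm_lt_one hq
  refine summable_norm_mul_inverse hpow ?_
  simpa [Nat.cofinite_eq_atTop] using (hpow.of_norm.tendsto_cofinite_zero.const_sub 1).pow 2

theorem summable_uTerm {t : ℕ} (p : (Fin t → ℕ+) → Prop) :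
    Summable fun k : {k : Fin t → ℕ+ // p k} => uTerm q k.1 := by
  simp_rw [uTerm_eq_prod]
  exact summable_prod_subtype ((summable_norm_ratio hq).comp_injective PNat.coe_injective) p

theorem summable_cTerm {t : ℕ} (p : (Fin t → ℕ+) → Prop) :
    Summable fun s : {s : Fin t → ℕ+ // p s} => cTerm q s.1 := by
  simp_rw [cTerm_eq_prod]
  exact summable_prod_subtype ((summable_norm_ratio hq).comp_injective injective_two_mul_sub_one) p

variable [NormOneClass R]

theorem isUnit_one_sub_pow {n : ℕ} (hn : 1 ≤ n) : IsUnit (1 - q ^ n) :=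
  isUnit_one_sub_of_norm_lt_one (norm_pow_lt_one hq hn)

theorem hasProd_euler : HasProd (fun n : ℕ => 1 - q ^ (n + 1)) (euler q) := by
  have hpow := (summable_nat_add_iff 1).2 (summable_norm_geometric_of_norm_lt_one hq)
  rw [euler_eq_tprod]
  exact (multipliable_one_sub hpow).hasProd

theorem multipliable_qPoch_self : Multipliable fun n : ℕ => 1 - q * q ^ n := by
  simpa only [pow_succ'] using (hasProd_euler hq).multipliable

theorem isUnit_euler : IsUnit (euler q) := by
  have hpow := (summable_nat_add_iff 1).2 (summable_norm_geometric_of_norm_lt_one hq)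
  rw [euler_eq_tprod]
  exact isUnit_tprod_one_sub (fun n => norm_pow_lt_one hq n.succ_pos) hpow

theorem hasProd_one_add_ratio :
    HasProd (fun n : ℕ => 1 + ratio q (n + 1)) (∏' n : ℕ, (1 + ratio q (n + 1))) :=
  (multipliable_one_add_of_summable
    ((summable_norm_ratio hq).comp_injective (add_left_injective 1))).hasProd

theorem tprod_one_add_ratio_mul :
    (∏' n : ℕ, (1 + ratio q (n + 1))) * (euler q * euler (q ^ 2) * euler (q ^ 3)) =
      euler (q ^ 6) := by
  have he {m : ℕ} (hm : 1 ≤ m) := hasProd_euler (norm_pow_lt_one hq hm)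
  refine HasProd.unique ((hasProd_one_add_ratio hq).mul
    (((hasProd_euler hq).mul (he one_le_two)).mul (he (m := 3) (by norm_num)))) ?_
  simpa only [one_add_ratio_mul (isUnit_one_sub_pow hq (Nat.succ_pos _))] using
    he (m := 6) (by norm_num)

theorem tprod_one_add_ratio_odd_mul_even :
    (∏' n : ℕ, (1 + ratio q (2 * n + 1))) * ∏' n : ℕ, (1 + ratio (q ^ 2) (n + 1)) =
      ∏' n : ℕ, (1 + ratio q (n + 1)) := by
  have hinj : Function.Injective fun n : ℕ => 2 * n + 1 := fun a b h => by simpa using h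
  have hsum : Summable fun n : ℕ => ‖ratio q (2 * n + 1)‖ :=
    (summable_norm_ratio hq).comp_injective hinj
  have hodd := (multipliable_one_add_of_summable hsum).hasProd
  have heven := hasProd_one_add_ratio (norm_pow_lt_one hq one_le_two)
  simp only [ratio_sq] at heven ⊢
  have hall := HasProd.even_mul_odd (f := fun n : ℕ => 1 + ratio q (n + 1)) hodd heven
  exact hall.unique (hasProd_one_add_ratio hq)

theorem tprod_one_add_ratio_odd_mul :
    (∏' n : ℕ, (1 + ratio q (2 * n + 1))) * (euler q * euler (q ^ 3) * euler (q ^ 12)) =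
      euler (q ^ 4) * euler (q ^ 6) ^ 2 := by
  have hsplit := tprod_one_add_ratio_odd_mul_even hq
  have hprod := tprod_one_add_ratio_mul hq
  have hprod_sq := tprod_one_add_ratio_mul (norm_pow_lt_one hq one_le_two)
  simp only [← pow_mul, Nat.reduceMul] at hprod_sq
  rw [← hprod_sq]
  linear_combination euler (q ^ 4) * euler (q ^ 6) *
    (euler q * euler (q ^ 2) * euler (q ^ 3) * hsplit + hprod)

theorem hasSum_U : HasSum (fun t : ℕ => U t q)
    (euler (q ^ 6) * Ring.inverse (euler q * euler (q ^ 2) * euler (q ^ 3))) := by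
  have hu {m : ℕ} (hm : 1 ≤ m) := isUnit_euler (norm_pow_lt_one hq hm)
  have hunit : IsUnit (euler q * euler (q ^ 2) * euler (q ^ 3)) :=
    ((isUnit_euler hq).mul (hu one_le_two)).mul (hu (by norm_num))
  have hsum := hasSum_strictChain ((summable_norm_ratio hq).comp_injective PNat.coe_injective)
  rw [← (Ring.eq_mul_inverse_iff_mul_eq _ _ _ hunit).2 (tprod_one_add_ratio_mul hq),
    ← tprod_pnat_eq_tprod_succ (f := fun n : ℕ => 1 + ratio q n)]
  simpa only [U, uTerm_eq_prod] using hsum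

theorem hasSum_C : HasSum (fun t : ℕ => C t q)
    (euler (q ^ 4) * euler (q ^ 6) ^ 2 *
      Ring.inverse (euler q * euler (q ^ 3) * euler (q ^ 12))) := by
  have hu {m : ℕ} (hm : 1 ≤ m) := isUnit_euler (norm_pow_lt_one hq hm)
  have hunit : IsUnit (euler q * euler (q ^ 3) * euler (q ^ 12)) :=
    ((isUnit_euler hq).mul (hu (by norm_num))).mul (hu (by norm_num))
  have hsum := hasSum_strictChain
    ((summable_norm_ratio hq).comp_injective injective_two_mul_sub_one)
  have hshift := tprod_pnat_eq_tprod_succ (f := fun n : ℕ => 1 + ratio q (2 * n - 1))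
  simp only [mul_add_one, Nat.add_succ_sub_one] at hshift
  rw [← (Ring.eq_mul_inverse_iff_mul_eq _ _ _ hunit).2 (tprod_one_add_ratio_odd_mul hq), ← hshift]
  simpa only [C, cTerm_eq_prod] using hsum

end UnitDisc

section Star

theorem tendsto_sum_range_mul {R : Type*} [NormedRing R] [CompleteSpace R] {t v w : ℕ → R}
    {a b : R} (ht : Summable fun i => ‖t i‖) (hv : Tendsto v atTop (𝓝 a))
    (hw : Tendsto w atTop (𝓝 b)) :
    Tendsto (fun n => ∑ i ∈ range (n + 1), t i * v (n - i) * w (n + i)) atTop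
      (𝓝 ((∑' i, t i) * a * b)) := by
  obtain ⟨A, hA⟩ := (Metric.isBounded_range_of_tendsto v hv).exists_norm_le
  obtain ⟨B, hB⟩ := (Metric.isBounded_range_of_tendsto w hw).exists_norm_le
  rw [Set.forall_mem_range] at hA hB
  have hA0 : 0 ≤ A := (norm_nonneg _).trans (hA 0)
  let F (n i : ℕ) : R := if i ∈ range (n + 1) then t i * v (n - i) * w (n + i) else 0
  have hF (n : ℕ) : ∑' i, F n i = ∑ i ∈ range (n + 1), t i * v (n - i) * w (n + i) :=
    (tsum_eq_sum fun i hi => if_neg hi).trans (sum_congr rfl fun i hi => if_pos hi)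
  rw [← ht.of_norm.tsum_mul_right, ← (ht.of_norm.mul_right a).tsum_mul_right]
  simp_rw [← hF]
  refine tendsto_tsum_of_dominated_convergence (f := F) ((ht.mul_right A).mul_right B) (fun i => ?_)
    (Eventually.of_forall fun n i => ?_)
  · have hlim : Tendsto (fun n => t i * v (n - i) * w (n + i)) atTop (𝓝 (t i * a * b)) :=
      ((hv.comp (tendsto_sub_atTop_nat i)).const_mul (t i)).mul
        (hw.comp (tendsto_add_atTop_nat i))
    refine hlim.congr' ?_
    filter_upwards [eventually_ge_atTop i] with n hn
    exact (if_pos (mem_range_succ_iff.2 hn)).symm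
  · by_cases hi : i ∈ range (n + 1)
    · simp only [F, if_pos hi]
      calc ‖t i * v (n - i) * w (n + i)‖ ≤ ‖t i‖ * ‖v (n - i)‖ * ‖w (n + i)‖ := norm_mul₃_le
        _ ≤ ‖t i‖ * A * B := by gcongr <;> simp only [hA, hB]
    · simp only [F, if_neg hi, norm_zero]
      have := (norm_nonneg _).trans (hB 0)
      positivity

variable {R : Type*} [NormedCommRing R] [NormOneClass R] {q : R} (hq : ‖q‖ < 1)
include hq

theorem norm_starNum_le (i : ℕ) : ‖starNum q i‖ ≤ 4 := by
  have hle (m : ℕ) : ‖q ^ m‖ ≤ 1 :=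
    (norm_pow_le q m).trans (pow_le_one₀ (norm_nonneg q) hq.le)
  have htwo (m : ℕ) : ‖1 - q ^ m‖ ≤ 2 := by
    linarith [norm_sub_le 1 (q ^ m), hle m, norm_one (α := R)]
  have hsign : ‖(-1 : R) ^ i‖ ≤ 1 := (norm_pow_le _ _).trans (by simp)
  rw [starNum, show (4 : ℝ) = 1 * 2 * 2 * 1 by norm_num]
  refine norm_mul_le_of_le (norm_mul_le_of_le (norm_mul_le_of_le hsign ?_) ?_) (hle _)
  exacts [htwo _, htwo _]

variable [CompleteSpace R]

theorem tendsto_qFac : Tendsto (qFac q) atTop (𝓝 (euler q)) :=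
  (hasProd_euler hq).tendsto_prod_nat

theorem tendsto_invFac : Tendsto (invFac q) atTop (𝓝 (Ring.inverse (euler q))) :=
  tendsto_ringInverse (isUnit_euler hq) (tendsto_qFac hq)

theorem summable_norm_starTerm : Summable fun n => ‖starTerm q n‖ := by
  have hpow := summable_norm_geometric_of_norm_lt_one hq
  have hnum : Summable fun i => ‖q ^ i * starNum q i‖ :=
    (hpow.mul_right _).of_nonneg_of_le (fun _ => norm_nonneg _) fun i =>
      norm_mul_le_of_le le_rfl (norm_starNum_le hq i)
  have hzero : Tendsto (fun i : ℕ => q ^ (i + 1)) cofinite (𝓝 0) :=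
    ((summable_nat_add_iff 1).2 hpow).of_norm.tendsto_cofinite_zero
  have hquad : Tendsto (fun i => quad q (i + 1)) cofinite (𝓝 1) := by
    simpa [quad, pow_mul'] using ((hzero.const_mul 3).const_sub 1).add (hzero.pow 2)
  have hsum := summable_norm_mul_inverse hnum hquad
  simp_rw [← starTerm_succPNat] at hsum
  exact Equiv.pnatEquivNat.symm.summable_iff.1 hsum

theorem tendsto_starSum : Tendsto (starSum q) atTop
    (𝓝 ((∑' n : ℕ+, starTerm q n) * Ring.inverse (euler q) * Ring.inverse (euler q))) := by
  have ht : Summable fun i : ℕ => ‖starTerm q i.succPNat‖ :=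
    (summable_norm_starTerm hq).comp_injective Nat.succPNat_injective
  have hinv := tendsto_invFac hq
  have hlim := tendsto_sum_range_mul ht hinv (hinv.comp (tendsto_add_atTop_nat 2))
  have htsum : ∑' i : ℕ, starTerm q i.succPNat = ∑' n : ℕ+, starTerm q n :=
    Equiv.pnatEquivNat.symm.tsum_eq _
  rw [← htsum]
  refine hlim.congr fun n => sum_congr rfl fun i _ => ?_
  simp only [Function.comp_apply, add_right_comm n i 2]

theorem inverse_one_sub_ratio {n : ℕ} (hn : 1 ≤ n) :
    Ring.inverse (1 - ratio q n) = (1 - q ^ n) ^ 2 * Ring.inverse (quad q n) := by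
  have hu := isUnit_one_sub_pow hq hn
  rw [quad_eq_mul hu, Ring.mul_inverse_rev, mul_left_comm, Ring.mul_inverse_cancel _ (hu.pow 2),
    mul_one]

variable (hratio : ∀ n, 1 ≤ n → ‖ratio q n‖ < 1)
include hratio

theorem isUnit_quad {n : ℕ} (hn : 1 ≤ n) : IsUnit (quad q n) := by
  have hu := isUnit_one_sub_pow hq hn
  rw [quad_eq_mul hu]
  exact (hu.pow 2).mul (isUnit_one_sub_of_norm_lt_one (hratio n hn))

theorem tprod_inverse_one_sub_ratio :
    ∏' n : ℕ, Ring.inverse (1 - ratio q (n + 1)) = ∑' n : ℕ+, starTerm q n := by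
  have hu := Ring.mul_inverse_cancel _ (isUnit_euler hq)
  have hfin (n : ℕ) : ∏ i ∈ range (n + 1), Ring.inverse (1 - ratio q (i + 1)) =
      qFac q (n + 1) ^ 2 * starSum q n := by
    rw [← prod_inverse_quad_eq_starSum (fun _ => isUnit_one_sub_pow hq)
      (fun _ => isUnit_quad hq hratio), qFac, ← prod_pow, ← prod_mul_distrib]
    exact prod_congr rfl fun i _ => inverse_one_sub_ratio hq i.succ_pos
  have hsum : Summable fun n => ‖ratio q (n + 1)‖ :=
    (summable_norm_ratio hq).comp_injective (add_left_injective 1)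
  have hmul := multipliable_inverse_one_sub (fun n => hratio (n + 1) n.succ_pos) hsum
  have hprod := hmul.hasProd.tendsto_prod_nat
  have hlim := (((tendsto_qFac hq).comp (tendsto_add_atTop_nat 1)).pow 2).mul (tendsto_starSum hq)
  have heq := tendsto_nhds_unique (hprod.comp (tendsto_add_atTop_nat 1))
    (hlim.congr fun n => (hfin n).symm)
  rw [heq]
  linear_combination (∑' n : ℕ+, starTerm q n) * (euler q * Ring.inverse (euler q) + 1) * hu

theorem hasSum_UStar : HasSum (fun t : ℕ => UStar t q) (∑' n : ℕ+, starTerm q n) := by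
  have hsum := hasSum_weakChain (fun k : ℕ+ => hratio k k.pos)
    ((summable_norm_ratio hq).comp_injective PNat.coe_injective)
  rw [← tprod_inverse_one_sub_ratio hq hratio,
    ← tprod_pnat_eq_tprod_succ (f := fun n : ℕ => Ring.inverse (1 - ratio q n))]
  simpa only [UStar, uTerm_eq_prod] using hsum

end Star

/-! ### The `X`-adic norm -/

section PowerSeriesNorm

variable (A : Type*) [CommRing A] [UniformSpace A]

theorem isUniformEmbedding_coeff :
    IsUniformEmbedding fun (f : A⟦X⟧) (n : ℕ) => PowerSeries.coeff n f :=
  (UniformEquiv.piCongrLeft (β := fun _ : Unit →₀ ℕ => A)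
    (Finsupp.uniqueLinearEquiv ℕ ℕ ()).symm.toEquiv).symm.isUniformEmbedding

variable [DiscreteUniformity A]

/-- The metric `dist f g = 2 ^ (-n)`, with `n` the first index at which the coefficients of `f` and
`g` differ. Its uniformity is by definition that of coefficientwise convergence. -/
@[reducible] noncomputable def coeffMetricSpace : MetricSpace A⟦X⟧ :=
  letI := PiNat.metricSpaceOfDiscreteUniformity (E := fun _ : ℕ => A)
    fun _ => DiscreteUniformity.eq_principal_setRelId A
  (isUniformEmbedding_coeff A).comapMetricSpace _

section Metric

attribute [local instance] coeffMetricSpace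

variable {A}

theorem dist_le_pow_iff {f g : A⟦X⟧} {n : ℕ} :
    dist f g ≤ (1 / 2) ^ n ↔ ∀ i < n, PowerSeries.coeff i f = PowerSeries.coeff i g := by
  rw [← PiNat.mem_cylinder_iff, PiNat.mem_cylinder_iff_dist_le]
  rfl

theorem exists_dist_eq_pow {f g : A⟦X⟧} (h : f ≠ g) : ∃ n : ℕ, dist f g = (1 / 2) ^ n :=
  ⟨_, PiNat.dist_eq_of_ne ((isUniformEmbedding_coeff A).injective.ne h)⟩

theorem dist_neg_add (f g : A⟦X⟧) : dist (-f + g) 0 = dist f g := by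
  have hle (n : ℕ) : dist (-f + g) 0 ≤ (1 / 2) ^ n ↔ dist f g ≤ (1 / 2) ^ n := by
    simp only [dist_le_pow_iff, map_add, map_neg, map_zero, neg_add_eq_zero]
  obtain rfl | h := eq_or_ne f g
  · simp only [neg_add_cancel, dist_self]
  obtain ⟨a, ha⟩ := exists_dist_eq_pow h
  obtain ⟨b, hb⟩ := exists_dist_eq_pow (mt neg_add_eq_zero.1 h)
  exact le_antisymm (ha ▸ (hle a).2 ha.le) (hb ▸ (hle b).1 hb.le)

theorem dist_mul_zero_le (f g : A⟦X⟧) : dist (f * g) 0 ≤ dist f 0 * dist g 0 := by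
  obtain rfl | hf := eq_or_ne f 0
  · simp
  obtain rfl | hg := eq_or_ne g 0
  · simp
  obtain ⟨a, ha⟩ := exists_dist_eq_pow hf
  obtain ⟨b, hb⟩ := exists_dist_eq_pow hg
  have hfa := dist_le_pow_iff.1 ha.le
  have hgb := dist_le_pow_iff.1 hb.le
  rw [ha, hb, ← pow_add, dist_le_pow_iff]
  intro i hi
  rw [PowerSeries.coeff_mul]
  refine sum_eq_zero fun p hp => ?_
  rcases lt_or_ge p.1 a with h | h
  · rw [hfa _ h, map_zero, zero_mul]
  · rw [hgb p.2 (by have := HasAntidiagonal.mem_antidiagonal.1 hp; omega), map_zero, mul_zero]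

end Metric

/-- The ring `A⟦X⟧` with the `X`-adic norm `2 ^ (-order f)`. Its uniformity is by definition that of
coefficientwise convergence, so that limits agree with those of `PowerSeries.WithPiTopology`. -/
@[reducible] noncomputable def normedPowerSeries : NormedCommRing A⟦X⟧ where
  __ := (inferInstance : CommRing A⟦X⟧)
  __ := coeffMetricSpace A
  norm f := dist f 0
  dist_eq f g := (dist_neg_add f g).symm
  norm_mul_le := dist_mul_zero_le

attribute [local instance] normedPowerSeries

variable {A}

theorem norm_one_powerSeries [Nontrivial A] : ‖(1 : A⟦X⟧)‖ = 1 := by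
  obtain ⟨n, hn⟩ := exists_dist_eq_pow (one_ne_zero (α := A⟦X⟧))
  have hn0 : n = 0 := by
    by_contra h
    simpa using dist_le_pow_iff.1 hn.le 0 (Nat.pos_of_ne_zero h)
  rwa [hn0, pow_zero] at hn

theorem norm_lt_one_of_constantCoeff_eq_zero {f : A⟦X⟧} (h : PowerSeries.constantCoeff f = 0) :
    ‖f‖ < 1 := by
  refine lt_of_le_of_lt ((dist_le_pow_iff (n := 1)).2 fun i hi => ?_) (by norm_num)
  rw [Nat.lt_one_iff.1 hi, map_zero, PowerSeries.coeff_zero_eq_constantCoeff_apply, h]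

theorem norm_ratio_X_lt_one {n : ℕ} (hn : 1 ≤ n) : ‖ratio (PowerSeries.X : A⟦X⟧) n‖ < 1 := by
  refine norm_lt_one_of_constantCoeff_eq_zero ?_
  rw [ratio, map_mul, map_pow, PowerSeries.constantCoeff_X, zero_pow (by omega), zero_mul]

end PowerSeriesNorm

theorem norm_ratio_lt_one_iff {K : Type*} [NormedField K] {q : K} {n : ℕ} (h : 1 - q ^ n ≠ 0) :
    ‖ratio q n‖ < 1 ↔ ‖q ^ n‖ < ‖1 - q ^ n‖ ^ 2 := by
  rw [ratio, Ring.inverse_eq_inv', ← div_eq_mul_inv, norm_div, norm_pow (1 - q ^ n),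
    div_lt_one (by positivity)]

end MacMahon

theorem proposition5p2_general {R : Type*} [NormedCommRing R] [NormOneClass R] [CompleteSpace R]
    {q : R} (hq : ‖q‖ < 1) :
    (∀ t : ℕ,
      Summable (fun k : {k : Fin t → ℕ+ // StrictMono k} => MacMahon.uTerm q k.1) ∧
      Summable (fun s : {s : Fin t → ℕ+ // StrictMono s} => MacMahon.cTerm q s.1) ∧
      Summable (fun k : {k : Fin t → ℕ+ // Monotone k} => MacMahon.uTerm q k.1)) ∧
    (∀ m : ℕ, 1 ≤ m → Multipliable (fun n : ℕ => 1 - q ^ m * (q ^ m) ^ n)) ∧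
    Summable (fun n : ℕ+ => MacMahon.starTerm q n) ∧
    HasSum (fun t : ℕ => MacMahon.U t q)
      (MacMahon.euler (q ^ 6) *
        Ring.inverse (MacMahon.euler q * MacMahon.euler (q ^ 2) * MacMahon.euler (q ^ 3))) ∧
    HasSum (fun t : ℕ => MacMahon.C t q)
      (MacMahon.euler (q ^ 4) * MacMahon.euler (q ^ 6) ^ 2 *
        Ring.inverse (MacMahon.euler q * MacMahon.euler (q ^ 3) * MacMahon.euler (q ^ 12))) ∧
    ((∀ n, 1 ≤ n → ‖MacMahon.ratio q n‖ < 1) →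
      HasSum (fun t : ℕ => MacMahon.UStar t q) (∑' n : ℕ+, MacMahon.starTerm q n)) :=
  ⟨fun _ =>
      ⟨MacMahon.summable_uTerm hq _, MacMahon.summable_cTerm hq _, MacMahon.summable_uTerm hq _⟩,
    fun _ hm => MacMahon.multipliable_qPoch_self (MacMahon.norm_pow_lt_one hq hm),
    (MacMahon.summable_norm_starTerm hq).of_norm, MacMahon.hasSum_U hq, MacMahon.hasSum_C hq,
    MacMahon.hasSum_UStar hq⟩

theorem proposition5p2 :
    -- The identities between formal power series in the variable `q`.
    (∀ q : ℤ⟦X⟧, q = PowerSeries.X →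
      -- all the series and products involved converge
      (∀ t : ℕ,
        Summable (fun k : {k : Fin t → ℕ+ // StrictMono k} => MacMahon.uTerm q k.1) ∧
        Summable (fun s : {s : Fin t → ℕ+ // StrictMono s} => MacMahon.cTerm q s.1) ∧
        Summable (fun k : {k : Fin t → ℕ+ // Monotone k} => MacMahon.uTerm q k.1)) ∧
      (∀ m : ℕ, 1 ≤ m → Multipliable (fun n : ℕ => 1 - q ^ m * (q ^ m) ^ n)) ∧
      Summable (fun n : ℕ+ => MacMahon.starTerm q n) ∧
      -- the three identities
      HasSum (fun t : ℕ => MacMahon.U t q)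
        (MacMahon.euler (q ^ 6) *
          Ring.inverse (MacMahon.euler q * MacMahon.euler (q ^ 2) * MacMahon.euler (q ^ 3))) ∧
      HasSum (fun t : ℕ => MacMahon.C t q)
        (MacMahon.euler (q ^ 4) * MacMahon.euler (q ^ 6) ^ 2 *
          Ring.inverse (MacMahon.euler q * MacMahon.euler (q ^ 3) * MacMahon.euler (q ^ 12))) ∧
      HasSum (fun t : ℕ => MacMahon.UStar t q) (∑' n : ℕ+, MacMahon.starTerm q n)) ∧
    -- The identities between functions of a complex number `q` in the unit disc.
    (∀ q : ℂ, ‖q‖ < 1 →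
      (∀ t : ℕ,
        Summable (fun k : {k : Fin t → ℕ+ // StrictMono k} => MacMahon.uTerm q k.1) ∧
        Summable (fun s : {s : Fin t → ℕ+ // StrictMono s} => MacMahon.cTerm q s.1) ∧
        Summable (fun k : {k : Fin t → ℕ+ // Monotone k} => MacMahon.uTerm q k.1)) ∧
      (∀ m : ℕ, 1 ≤ m → Multipliable (fun n : ℕ => 1 - q ^ m * (q ^ m) ^ n)) ∧
      Summable (fun n : ℕ+ => MacMahon.starTerm q n) ∧
      HasSum (fun t : ℕ => MacMahon.U t q)
        (MacMahon.euler (q ^ 6) /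
          (MacMahon.euler q * MacMahon.euler (q ^ 2) * MacMahon.euler (q ^ 3))) ∧
      HasSum (fun t : ℕ => MacMahon.C t q)
        (MacMahon.euler (q ^ 4) * MacMahon.euler (q ^ 6) ^ 2 /
          (MacMahon.euler q * MacMahon.euler (q ^ 3) * MacMahon.euler (q ^ 12))) ∧
      -- the sum over `t` of the starred series converges where `|q^n / (1-q^n)²| < 1` for all `n`
      ((∀ n : ℕ, 1 ≤ n → ‖q ^ n‖ < ‖1 - q ^ n‖ ^ 2) →
        HasSum (fun t : ℕ => MacMahon.UStar t q) (∑' n : ℕ+, MacMahon.starTerm q n))) := by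
  refine ⟨?_, fun q hq => ?_⟩
  · rintro q rfl
    let _ := MacMahon.normedPowerSeries ℤ
    have : NormOneClass ℤ⟦X⟧ := ⟨MacMahon.norm_one_powerSeries⟩
    have : CompleteSpace ℤ⟦X⟧ := PowerSeries.WithPiTopology.instCompleteSpace ℤ
    obtain ⟨hchain, hprod, hstar, hU, hC, hUStar⟩ := proposition5p2_general
      (MacMahon.norm_lt_one_of_constantCoeff_eq_zero (A := ℤ) PowerSeries.constantCoeff_X)
    exact ⟨hchain, hprod, hstar, hU, hC, hUStar fun n hn => MacMahon.norm_ratio_X_lt_one hn⟩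
  · obtain ⟨hchain, hprod, hstar, hU, hC, hUStar⟩ := proposition5p2_general hq
    simp only [Ring.inverse_eq_inv', ← div_eq_mul_inv] at hU hC
    exact ⟨hchain, hprod, hstar, hU, hC, fun h => hUStar fun n hn =>
      (MacMahon.norm_ratio_lt_one_iff (MacMahon.isUnit_one_sub_pow hq hn).ne_zero).2 (h n hn)⟩
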